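/- Graphs are finite and simple and have at least one vertex. Let $\mathcal S$ be a set of connected graphs. For $n\ge 0$, let $K_n$ be the complete graph on $n$ labelled vertices, and consider its spanning subgraphs (the subgraphs containing all $n$ vertices; for $n=0$ there are none, since a graph has at least one vertex). Let * $c_n$ be the number of spanning subgraphs of $K_n$ that are isomorphic to one of the graphs in $\mathcal S$; * $w_{k,n}$, for each positive integer $k$, be the number of spanning subgraphs of $K_n$ that have exactly $k$ connected components, each of them isomorphic to one of the graphs in $\mathcal S$; * $a_n$ be the number of all spanning subgraphs of $K_n$ each of whose connected components is isomorphic to one of the graphs in $\mathcal S$. Let $C(x)=\sum_{n\ge0}\frac{c_n}{n!}x^n$, $W_k(x)=\sum_{n\ge0}\frac{w_{k,n}}{n!}x^n$ and $A(x)=\sum_{n\ge0}\frac{a_n}{n!}x^n$ be the exponential generating functions of these sequences, regarded as formal power series over $\mathbb Q$. Then: (a) $W_k(x)=\frac1{k!}\,C(x)^k$ for every positive integer $k$. (b) $C(0)=A(0)=0$ and $1+A(x)=e^{C(x)}$. (c) Consequently, $\ln[1+A(x)]=C(x)$ and $A'(x)=[1+A(x)]\cdot C'(x)$. -/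

import Mathlib

/-- A graph: a finite nonempty set of vertices, no loops and no parallel edges. -/
structure FinGraph where
  /-- The vertices. -/
  V : Type*
  /-- The adjacency relation. -/
  graph : SimpleGraph V
  finite : Finite V
  nonempty : Nonempty V

namespace FinGraph

/-- The simple graph `H` is isomorphic to one of the graphs in `S`. -/
def IsoMem (S : Set FinGraph) {W : Type*} (H : SimpleGraph W) : Prop :=
  ∃ G ∈ S, Nonempty (H ≃g G.graph)

/-- The set of spanning subgraphs of the complete graph `K_n` on the vertex set `Fin n`.
A graph has at least one vertex, so this set is empty for `n = 0`. -/
def spanningSubgraphs (n : ℕ) : Set (SimpleGraph.completeGraph (Fin n)).Subgraph :=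
  {H | H.IsSpanning ∧ H.verts.Nonempty}

/-- `c_n`: the number of spanning subgraphs of `K_n` isomorphic to one of the graphs in `S`. -/
noncomputable def countIso (S : Set FinGraph) (n : ℕ) : ℕ :=
  {H | H ∈ spanningSubgraphs n ∧ IsoMem S H.coe}.ncard

/-- `w_n`: the number of spanning subgraphs of `K_n` with exactly `k` connected components,
each of them isomorphic to one of the graphs in `S`. -/
noncomputable def countComponents (S : Set FinGraph) (k n : ℕ) : ℕ :=
  {H | H ∈ spanningSubgraphs n ∧ Nat.card H.coe.ConnectedComponent = k ∧
    ∀ c : H.coe.ConnectedComponent, IsoMem S c.toSimpleGraph}.ncard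

/-- `a_n`: the number of all spanning subgraphs of `K_n` such that each connected component
is isomorphic to one of the graphs in `S`. -/
noncomputable def countAll (S : Set FinGraph) (n : ℕ) : ℕ :=
  {H | H ∈ spanningSubgraphs n ∧
    ∀ c : H.coe.ConnectedComponent, IsoMem S c.toSimpleGraph}.ncard

/-- The exponential generating function `∑ aₙ xⁿ / n!` of a sequence, as a formal power series. -/
noncomputable def expGenFun (a : ℕ → ℕ) : PowerSeries ℚ :=
  PowerSeries.mk fun n => (a n : ℚ) / (n.factorial : ℚ)

end FinGraph

/-! Everything follows from one differential equation. Let `B_N` be the exponential generating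
function of graphs whose components lie in `S` and whose number of components lies in `N`. Deleting
the component of vertex `0` from a graph on `n + 1` vertices gives `B_N' = B_{N-1} * C'`, where `N-1
= {k | k + 1 ∈ N}` (`derivative_expGenFun_compGraphs`). For `N = {k + 1}` the shift is `{k}`, and
induction gives `C ^ k / k!`. For `N = Set.univ` the shift is `N` itself, so `1 + A` solves `F' = F
* C'`, as does `exp C`; both have constant term 1, hence they agree. The logarithm is identified by
comparing derivatives and constant terms. -/

namespace PowerSeries

/-! ### Differential equations for formal exponentials and logarithms -/

/-- A linear differential equation `f' = h f` has at most one formal solution with a given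
constant coefficient. -/
theorem eq_of_derivative_eq_mul {f g h : PowerSeries ℚ}
    (hf : derivative ℚ f = f * h) (hg : derivative ℚ g = g * h)
    (h0 : constantCoeff f = constantCoeff g) : f = g := by
  ext n
  induction n using Nat.strong_induction_on with
  | _ n ih =>
    cases n with
    | zero => simpa using h0
    | succ n =>
      have hfn := congrArg (coeff n) hf
      have hgn := congrArg (coeff n) hg
      rw [coeff_derivative, coeff_mul] at hfn hgn
      -- The `n`-th coefficient of `f * h` involves only coefficients of `f` up to `n`, which the
      -- induction covers.
      have hsum : ∑ p ∈ Finset.HasAntidiagonal.antidiagonal n, coeff p.1 f * coeff p.2 h =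
          ∑ p ∈ Finset.HasAntidiagonal.antidiagonal n, coeff p.1 g * coeff p.2 h :=
        Finset.sum_congr rfl fun p hp => by
          rw [ih p.1 (Nat.lt_succ_of_le (by have := Finset.HasAntidiagonal.mem_antidiagonal.1 hp; omega))]
      rw [hsum, ← hgn] at hfn
      exact mul_right_cancel₀ (by positivity : (n + 1 : ℚ) ≠ 0) hfn

theorem derivative_exp_subst {f : PowerSeries ℚ} (hf : constantCoeff f = 0) :
    derivative ℚ ((exp ℚ).subst f) = (exp ℚ).subst f * derivative ℚ f := by
  rw [derivative_subst (HasSubst.of_constantCoeff_zero' hf), derivative_exp]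

theorem constantCoeff_exp_subst {f : PowerSeries ℚ} (hf : constantCoeff f = 0) :
    constantCoeff ((exp ℚ).subst f) = 1 := by
  have hs := HasSubst.of_constantCoeff_zero' hf
  have h : (exp ℚ).subst f = (exp ℚ - 1).subst f + 1 := by
    rw [subst_sub hs, ← coe_substAlgHom hs, map_one, sub_add_cancel]
  have h0 : constantCoeff ((exp ℚ - 1).subst f) = 0 :=
    constantCoeff_subst_eq_zero hf _ (by simp)
  rw [h, map_add, map_one, h0, zero_add]

theorem derivative_logOf {f : PowerSeries ℚ} (hf : constantCoeff f = 1) :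
    f * derivative ℚ (logOf f) = derivative ℚ f := by
  have hs : HasSubst (f - 1) := HasSubst.of_constantCoeff_zero' (by simp [hf])
  -- `log'` is the alternating geometric series; substituting `f - 1` turns `1 + X` into `f`.
  have hlog : (1 + X : PowerSeries ℚ) * derivative ℚ (log ℚ) = 1 := by
    rw [deriv_log]
    ext n
    cases n with
    | zero => simp [add_mul]
    | succ n => simp [add_mul, coeff_succ_X_mul, pow_succ, coeff_one]
  have hsub := congrArg (fun p => p.subst (f - 1)) hlog
  simp only [subst_mul hs, subst_add hs, subst_X hs] at hsub
  have h1 : (1 : PowerSeries ℚ).subst (f - 1) = (1 : PowerSeries ℚ) := by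
    rw [← coe_substAlgHom hs, map_one]
  rw [h1, add_sub_cancel] at hsub
  rw [logOf_eq, derivative_subst hs, ← mul_assoc, hsub, one_mul, map_sub, derivative_one, sub_zero]

end PowerSeries

/-! ### Splitting off and gluing back a component -/

namespace SimpleGraph

variable {V W : Type*} {G : SimpleGraph V} {H : SimpleGraph W}

/-- No edge leaves the range, so a walk starting in it lifts edge by edge. -/
theorem Embedding.exists_reachable_of_adj_closed (f : G ↪g H)
    (hf : ∀ a b, H.Adj (f a) b → b ∈ Set.range f) {a : V} {b : W} (h : H.Reachable (f a) b) :
    ∃ a', f a' = b ∧ G.Reachable a a' := by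
  obtain ⟨p⟩ := h
  generalize hx : f a = x at p
  induction p generalizing a with
  | nil => exact ⟨a, hx, .refl a⟩
  | cons hadj p ih =>
    subst hx
    obtain ⟨c, rfl⟩ := hf _ _ hadj
    obtain ⟨a', h1, h2⟩ := ih rfl
    exact ⟨a', h1, (f.map_adj_iff.1 hadj).reachable.trans h2⟩

theorem Embedding.reachable_iff_of_adj_closed (f : G ↪g H)
    (hf : ∀ a b, H.Adj (f a) b → b ∈ Set.range f) {a b : V} :
    H.Reachable (f a) (f b) ↔ G.Reachable a b := by
  refine ⟨fun h => ?_, fun h => h.map f.toHom⟩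
  obtain ⟨a', h1, h2⟩ := f.exists_reachable_of_adj_closed hf h
  rwa [← f.injective h1]

/-- An embedding with adjacency-closed range maps connected components isomorphically. -/
theorem Embedding.nonempty_iso_component (f : G ↪g H)
    (hf : ∀ a b, H.Adj (f a) b → b ∈ Set.range f) (a : V) :
    Nonempty ((G.connectedComponentMk a).toSimpleGraph ≃g
      (H.connectedComponentMk (f a)).toSimpleGraph) := by
  have hmem : ∀ x, x ∈ (G.connectedComponentMk a).supp →
      f x ∈ (H.connectedComponentMk (f a)).supp := fun x hx => by
    rw [ConnectedComponent.mem_supp_iff, ConnectedComponent.eq] at hx ⊢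
    exact hx.map f.toHom
  let g : (G.connectedComponentMk a).supp → (H.connectedComponentMk (f a)).supp :=
    fun x => ⟨f x.1, hmem x.1 x.2⟩
  have hg : Function.Bijective g := by
    constructor
    · intro x y hxy
      exact Subtype.ext (f.injective (congrArg Subtype.val hxy))
    · rintro ⟨y, hy⟩
      rw [ConnectedComponent.mem_supp_iff, ConnectedComponent.eq] at hy
      obtain ⟨x, rfl, hx⟩ := f.exists_reachable_of_adj_closed hf hy.symm
      exact ⟨⟨x, ConnectedComponent.sound hx.symm⟩, rfl⟩
  exact ⟨⟨Equiv.ofBijective g hg, f.map_adj_iff⟩⟩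

/-- The graph on `V` obtained from a graph on `s` and a graph on its complement. -/
def glue {V : Type*} (s : Set V) (p : SimpleGraph s × SimpleGraph ↥sᶜ) : SimpleGraph V :=
  p.1.map (Function.Embedding.subtype _) ⊔ p.2.map (Function.Embedding.subtype _)

theorem glue_adj_left {s : Set V} (p : SimpleGraph s × SimpleGraph ↥sᶜ) {a b : V} (ha : a ∈ s) :
    (glue s p).Adj a b ↔ ∃ hb : b ∈ s, p.1.Adj ⟨a, ha⟩ ⟨b, hb⟩ := by
  rw [glue, sup_adj, map_adj, map_adj]
  simp [ha]

theorem glue_adj_right {s : Set V} (p : SimpleGraph s × SimpleGraph ↥sᶜ) {a b : V} (ha : a ∉ s) :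
    (glue s p).Adj a b ↔ ∃ hb : b ∉ s, p.2.Adj ⟨a, ha⟩ ⟨b, hb⟩ := by
  rw [glue, sup_adj, map_adj, map_adj]
  simp [ha]

theorem induce_glue_left {s : Set V} (p : SimpleGraph s × SimpleGraph ↥sᶜ) :
    (glue s p).induce s = p.1 := by
  ext ⟨a, ha⟩ ⟨b, hb⟩
  simp [glue_adj_left p ha, hb]

theorem induce_glue_right {s : Set V} (p : SimpleGraph s × SimpleGraph ↥sᶜ) :
    (glue s p).induce sᶜ = p.2 := by
  ext ⟨a, ha⟩ ⟨b, hb⟩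
  have hb' : b ∉ s := hb
  simp [glue_adj_right p ha, hb']

theorem glue_injective (s : Set V) : Function.Injective (glue s) := fun p q h =>
  Prod.ext (by rw [← induce_glue_left p, h, induce_glue_left])
    (by rw [← induce_glue_right p, h, induce_glue_right])

theorem glue_induce {s : Set V} (hs : ∀ a b, G.Adj a b → a ∈ s → b ∈ s) :
    glue s (G.induce s, G.induce sᶜ) = G := by
  ext a b
  by_cases ha : a ∈ s
  · rw [glue_adj_left _ ha]
    exact ⟨fun ⟨_, h⟩ => h, fun h => ⟨hs a b h ha, h⟩⟩
  · rw [glue_adj_right _ ha]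
    exact ⟨fun ⟨_, h⟩ => h, fun h => ⟨fun hb => ha (hs b a h.symm hb), h⟩⟩

/-- No glued edge leaves `s`, and connectedness of `p.1` fills `s`. -/
theorem supp_component_glue {s : Set V} {p : SimpleGraph s × SimpleGraph ↥sᶜ}
    (hp : p.1.Connected) {v : V} (hv : v ∈ s) :
    ((glue s p).connectedComponentMk v).supp = s := by
  ext w
  rw [ConnectedComponent.mem_supp_iff, ConnectedComponent.eq]
  constructor
  · intro h
    obtain ⟨a, rfl, -⟩ := (Embedding.induce (G := glue s p) s).exists_reachable_of_adj_closed
      (fun a b hab => ⟨⟨b, ((glue_adj_left p a.2).1 hab).1⟩, rfl⟩) (a := ⟨v, hv⟩) h.symm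
    exact a.2
  · intro hw
    have h : ((glue s p).induce s).Reachable ⟨w, hw⟩ ⟨v, hv⟩ := by
      rw [induce_glue_left]
      exact hp.preconnected _ _
    exact h.map (Embedding.induce s).toHom

theorem adj_closed_compl_supp (c : G.ConnectedComponent) (a : ↥(c.suppᶜ)) (b : V)
    (h : G.Adj a b) : b ∈ Set.range (Embedding.induce (G := G) c.suppᶜ) :=
  ⟨⟨b, fun hb => a.2 (c.mem_supp_of_adj_mem_supp hb h.symm)⟩, rfl⟩

theorem card_connectedComponent_compl_supp [Finite V] (v : V) :
    Nat.card G.ConnectedComponent =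
      Nat.card (G.induce (G.connectedComponentMk v).suppᶜ).ConnectedComponent + 1 := by
  set s := (G.connectedComponentMk v).suppᶜ with hs
  let f : G.induce s ↪g G := Embedding.induce s
  have hf : ∀ a b, G.Adj (f a) b → b ∈ Set.range f := adj_closed_compl_supp _
  -- `none` stands for the deleted component.
  let F : Option (G.induce s).ConnectedComponent → G.ConnectedComponent := fun o =>
    o.elim (G.connectedComponentMk v) (fun c => c.map f.toHom)
  have hF : Function.Bijective F := by
    constructor
    · have hne : ∀ c : (G.induce s).ConnectedComponent,
          c.map f.toHom ≠ G.connectedComponentMk v := by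
        intro c
        induction c using ConnectedComponent.ind with
        | _ a => exact fun h => a.2 h
      rintro (_ | c) (_ | d) h
      · rfl
      · exact absurd h.symm (hne d)
      · exact absurd h (hne c)
      · congr 1
        induction c using ConnectedComponent.ind with
        | _ a =>
        induction d using ConnectedComponent.ind with
        | _ b =>
        exact ConnectedComponent.sound
          ((f.reachable_iff_of_adj_closed hf).1 (ConnectedComponent.exact h))
    · intro c
      induction c using ConnectedComponent.ind with
      | _ w =>
      by_cases hw : w ∈ s
      · exact ⟨some ((G.induce s).connectedComponentMk ⟨w, hw⟩), rfl⟩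
      · rw [hs, Set.notMem_compl_iff] at hw
        exact ⟨none, hw.symm⟩
  rw [← Nat.card_eq_of_bijective F hF, Finite.card_option]

end SimpleGraph

/-! ### Counting by the component of a vertex -/

namespace FinGraph

open SimpleGraph

variable {S : Set FinGraph}

theorem isoMem_congr {V W : Type*} {G : SimpleGraph V} {H : SimpleGraph W} (e : G ≃g H) :
    IsoMem S G ↔ IsoMem S H :=
  ⟨fun ⟨K, hK, ⟨f⟩⟩ => ⟨K, hK, ⟨e.symm.trans f⟩⟩, fun ⟨K, hK, ⟨f⟩⟩ => ⟨K, hK, ⟨e.trans f⟩⟩⟩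

theorem IsoMem.nonempty {V : Type*} {G : SimpleGraph V} (h : IsoMem S G) : Nonempty V := by
  obtain ⟨K, -, ⟨f⟩⟩ := h
  exact K.nonempty.map f.symm

theorem IsoMem.connected (hS : ∀ G ∈ S, G.graph.Connected) {V : Type*} {G : SimpleGraph V}
    (h : IsoMem S G) : G.Connected := by
  obtain ⟨K, hK, ⟨f⟩⟩ := h
  exact f.connected_iff.2 (hS K hK)

/-- The graphs on `V` isomorphic to a member of `S`. -/
def isoGraphs (S : Set FinGraph) (V : Type*) : Set (SimpleGraph V) :=
  {H | IsoMem S H}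

/-- The graphs on `V` whose components are all isomorphic to members of `S` and whose number of
components lies in `N`. -/
def compGraphs (S : Set FinGraph) (N : Set ℕ) (V : Type*) : Set (SimpleGraph V) :=
  {H | Nat.card H.ConnectedComponent ∈ N ∧ ∀ c : H.ConnectedComponent, IsoMem S c.toSimpleGraph}

theorem mem_compGraphs_congr {N : Set ℕ} {V W : Type*} {G : SimpleGraph V} {H : SimpleGraph W}
    (e : G ≃g H) : G ∈ compGraphs S N V ↔ H ∈ compGraphs S N W := by
  have hcl : ∀ a b, H.Adj (e.toEmbedding a) b → b ∈ Set.range e.toEmbedding :=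
    fun _ b _ => e.surjective b
  have hcomp : ∀ a, IsoMem S (G.connectedComponentMk a).toSimpleGraph ↔
      IsoMem S (H.connectedComponentMk (e a)).toSimpleGraph := fun a =>
    isoMem_congr (e.toEmbedding.nonempty_iso_component hcl a).some
  refine and_congr (by rw [Nat.card_congr e.connectedComponentEquiv]) ⟨fun h c => ?_, fun h c => ?_⟩
  · induction c using ConnectedComponent.ind with
    | _ w =>
    obtain ⟨a, rfl⟩ := e.surjective w
    exact (hcomp a).1 (h _)
  · induction c using ConnectedComponent.ind with
    | _ a => exact (hcomp a).2 (h _)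

theorem ncard_isoGraphs_congr {V W : Type*} (e : V ≃ W) :
    (isoGraphs S V).ncard = (isoGraphs S W).ncard :=
  Set.ncard_congr' (e.simpleGraph.subtypeEquiv fun G => isoMem_congr
    (Iso.comap e.symm G).symm)

theorem ncard_compGraphs_congr {N : Set ℕ} {V W : Type*} (e : V ≃ W) :
    (compGraphs S N V).ncard = (compGraphs S N W).ncard :=
  Set.ncard_congr' (e.simpleGraph.subtypeEquiv fun G => mem_compGraphs_congr
    (Iso.comap e.symm G).symm)

theorem mem_compGraphs_iff_of_component {N : Set ℕ} {V : Type*}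
    [Finite V] (H : SimpleGraph V) (v : V) :
    H ∈ compGraphs S N V ↔ H.induce (H.connectedComponentMk v).supp ∈ isoGraphs S _ ∧
      H.induce (H.connectedComponentMk v).suppᶜ ∈ compGraphs S {k | k + 1 ∈ N} _ := by
  set c := H.connectedComponentMk v with hc
  have hcomp : ∀ a : ↥(c.suppᶜ),
      IsoMem S ((H.induce c.suppᶜ).connectedComponentMk a).toSimpleGraph ↔
        IsoMem S (H.connectedComponentMk a).toSimpleGraph := fun a =>
    isoMem_congr ((Embedding.induce c.suppᶜ).nonempty_iso_component
      (adj_closed_compl_supp c) a).some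
  simp only [compGraphs, isoGraphs, Set.mem_ofPred_eq]
  rw [card_connectedComponent_compl_supp v]
  constructor
  · rintro ⟨h1, h2⟩
    refine ⟨h2 c, h1, fun d => ?_⟩
    induction d using ConnectedComponent.ind with
    | _ a => exact (hcomp a).2 (h2 _)
  · rintro ⟨h1, h2, h3⟩
    refine ⟨h2, fun d => ?_⟩
    induction d using ConnectedComponent.ind with
    | _ w =>
    by_cases hw : w ∈ c.supp
    · rw [ConnectedComponent.mem_supp_iff] at hw
      rw [hw]
      exact h1
    · exact (hcomp ⟨w, hw⟩).1 (h3 _)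

/-- `glue s` is a bijection from pairs of admissible graphs on `s` and `sᶜ` onto this fiber;
connectedness of the members of `S` makes `s` a single component. -/
theorem ncard_compGraphs_fiber (hS : ∀ G ∈ S, G.graph.Connected) (N : Set ℕ) {V : Type*}
    [Finite V] {v : V} {s : Set V} (hv : v ∈ s) :
    {H | H ∈ compGraphs S N V ∧ (H.connectedComponentMk v).supp = s}.ncard =
      (isoGraphs S s).ncard * (compGraphs S {k | k + 1 ∈ N} ↥sᶜ).ncard := by
  rw [← Set.ncard_prod, ← Set.ncard_image_of_injective _ (glue_injective s)]
  congr 1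
  ext H
  constructor
  · rintro ⟨hH, rfl⟩
    refine ⟨(H.induce _, H.induce _), (mem_compGraphs_iff_of_component H v).1 hH, ?_⟩
    exact glue_induce fun a b hab ha => ConnectedComponent.mem_supp_of_adj_mem_supp _ ha hab
  · rintro ⟨p, ⟨hp1, hp2⟩, rfl⟩
    have hs := supp_component_glue (p := p) (IsoMem.connected hS hp1) hv
    refine ⟨(mem_compGraphs_iff_of_component _ v).2 ?_, hs⟩
    rw [hs, induce_glue_left, induce_glue_right]
    exact ⟨hp1, hp2⟩

/-- Sort by the `m` vertices outside the component of `0`: they form an arbitrary `m`-subset of the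
`n` nonzero vertices. -/
theorem ncard_compGraphs_succ (hS : ∀ G ∈ S, G.graph.Connected) (N : Set ℕ) (n : ℕ) :
    (compGraphs S N (Fin (n + 1))).ncard = ∑ m ∈ Finset.range (n + 1), n.choose m *
      ((isoGraphs S (Fin (n + 1 - m))).ncard *
        (compGraphs S {k | k + 1 ∈ N} (Fin m)).ncard) := by
  classical
  have hfin := Set.toFinite (compGraphs S N (Fin (n + 1)))
  let rest : SimpleGraph (Fin (n + 1)) → Finset (Fin (n + 1)) := fun H =>
    Finset.univ.filter (· ∉ (H.connectedComponentMk 0).supp)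
  have hmaps : ∀ H ∈ hfin.toFinset, rest H ∈ (Finset.univ.erase (0 : Fin (n + 1))).powerset := by
    intro H _
    rw [Finset.mem_powerset]
    intro a ha
    refine Finset.mem_erase.2 ⟨?_, Finset.mem_univ _⟩
    rintro rfl
    exact (Finset.mem_filter.1 ha).2 rfl
  rw [Set.ncard_eq_toFinset_card _ hfin, Finset.card_eq_sum_card_fiberwise hmaps]
  have hcard : (Finset.univ.erase (0 : Fin (n + 1))).card = n := by simp
  have hsum := Finset.sum_powerset_apply_card
    (fun m => (isoGraphs S (Fin (n + 1 - m))).ncard *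
      (compGraphs S {k | k + 1 ∈ N} (Fin m)).ncard) (x := Finset.univ.erase (0 : Fin (n + 1)))
  rw [hcard] at hsum
  simp only [← smul_eq_mul (a := n.choose _)]
  rw [← hsum]
  refine Finset.sum_congr rfl fun r hr => ?_
  have h0 : (0 : Fin (n + 1)) ∈ ((r : Set (Fin (n + 1)))ᶜ) := fun h =>
    (Finset.mem_erase.1 (Finset.mem_powerset.1 hr h)).1 rfl
  have hfib := ncard_compGraphs_fiber hS N h0
  rw [compl_compl] at hfib
  have e1 : ↥((r : Set (Fin (n + 1)))ᶜ) ≃ Fin (n + 1 - r.card) :=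
    Finite.equivFinOfCardEq (by
      rw [Nat.card_coe_set_eq, Set.ncard_compl, Set.ncard_coe_finset, Nat.card_fin])
  have e2 : ↥(r : Set (Fin (n + 1))) ≃ Fin r.card :=
    Finite.equivFinOfCardEq (by rw [Nat.card_coe_set_eq, Set.ncard_coe_finset])
  rw [ncard_isoGraphs_congr e1, ncard_compGraphs_congr e2] at hfib
  rw [← hfib, ← Set.ncard_coe_finset]
  congr 1
  ext H
  simp only [Finset.coe_filter, Set.Finite.mem_toFinset, Set.mem_ofPred_eq]
  refine and_congr_right fun _ => ?_
  rw [← Finset.coe_inj, ← compl_inj_iff]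
  have : ((rest H : Set (Fin (n + 1))))ᶜ = (H.connectedComponentMk 0).supp := by
    ext a
    simp [rest]
  rw [this]

/-! ### The differential equation -/

theorem derivative_expGenFun (a : ℕ → ℕ) :
    PowerSeries.derivative ℚ (expGenFun a) = expGenFun fun n => a (n + 1) := by
  ext n
  rw [PowerSeries.coeff_derivative, expGenFun, expGenFun, PowerSeries.coeff_mk,
    PowerSeries.coeff_mk, Nat.factorial_succ]
  push_cast
  field_simp

theorem derivative_expGenFun_compGraphs (hS : ∀ G ∈ S, G.graph.Connected) (N : Set ℕ) :
    PowerSeries.derivative ℚ (expGenFun fun n => (compGraphs S N (Fin n)).ncard) =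
      (expGenFun fun n => (compGraphs S {k | k + 1 ∈ N} (Fin n)).ncard) *
        PowerSeries.derivative ℚ (expGenFun fun n => (isoGraphs S (Fin n)).ncard) := by
  rw [derivative_expGenFun, derivative_expGenFun]
  ext n
  rw [PowerSeries.coeff_mul, Finset.Nat.sum_antidiagonal_eq_sum_range_succ_mk]
  simp only [expGenFun, PowerSeries.coeff_mk]
  rw [ncard_compGraphs_succ hS]
  push_cast
  rw [Finset.sum_div]
  refine Finset.sum_congr rfl fun m hm => ?_
  have hmn : m ≤ n := Nat.lt_succ_iff.1 (Finset.mem_range.1 hm)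
  rw [Nat.cast_choose ℚ hmn, Nat.succ_sub hmn]
  have := Nat.factorial_ne_zero n
  field_simp

/-! ### From spanning subgraphs to graphs on `Fin n` -/

theorem ncard_spanningSubgraphs {n : ℕ} (hn : n ≠ 0)
    {P : (completeGraph (Fin n)).Subgraph → Prop} {Q : SimpleGraph (Fin n) → Prop}
    (h : ∀ H : (completeGraph (Fin n)).Subgraph, H.IsSpanning → (P H ↔ Q H.spanningCoe)) :
    {H | H ∈ spanningSubgraphs n ∧ P H}.ncard = {H | Q H}.ncard := by
  refine Set.ncard_congr (fun H _ => H.spanningCoe) (fun H hH => (h H hH.1.1).1 hH.2) ?_ ?_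
  · intro H K hH hK hHK
    refine Subgraph.verts_spanningCoe_injective (Prod.ext ?_ hHK)
    change H.verts = K.verts
    rw [Subgraph.isSpanning_iff.1 hH.1.1, Subgraph.isSpanning_iff.1 hK.1.1]
  · intro H hH
    have hsp : (toSubgraph H (le_top : H ≤ completeGraph (Fin n))).IsSpanning :=
      fun _ => Set.mem_univ _
    exact ⟨toSubgraph H le_top, ⟨⟨hsp, ⟨⟨0, Nat.pos_of_ne_zero hn⟩, hsp _⟩⟩, (h _ hsp).2 hH⟩, rfl⟩

theorem ncard_spanningSubgraphs_zero (P : (completeGraph (Fin 0)).Subgraph → Prop) :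
    {H | H ∈ spanningSubgraphs 0 ∧ P H}.ncard = 0 := by
  rw [Set.ncard_eq_zero]
  exact Set.eq_empty_of_forall_notMem fun H hH => hH.1.2.some.elim0

theorem countIso_eq_ncard (n : ℕ) : countIso S n = (isoGraphs S (Fin n)).ncard := by
  rcases eq_or_ne n 0 with rfl | hn
  · rw [countIso, ncard_spanningSubgraphs_zero, eq_comm, Set.ncard_eq_zero]
    exact Set.eq_empty_of_forall_notMem fun H hH => (IsoMem.nonempty hH).some.elim0
  · exact ncard_spanningSubgraphs hn fun H hH =>
      isoMem_congr (H.spanningCoeEquivCoeOfSpanning hH).symm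

theorem countAll_eq_ncard {n : ℕ} (hn : n ≠ 0) :
    countAll S n = (compGraphs S Set.univ (Fin n)).ncard :=
  ncard_spanningSubgraphs hn fun H hH =>
    (iff_of_eq (true_and _).symm).trans
      (mem_compGraphs_congr (N := Set.univ) (H.spanningCoeEquivCoeOfSpanning hH)).symm

theorem countAll_zero : countAll S 0 = 0 :=
  ncard_spanningSubgraphs_zero _

theorem mem_compGraphs_of_isEmpty {N : Set ℕ} {V : Type*} [IsEmpty V] (H : SimpleGraph V) :
    H ∈ compGraphs S N V ↔ 0 ∈ N := by
  have : IsEmpty H.ConnectedComponent := ⟨fun c => c.nonempty_supp.elim fun v _ => isEmptyElim v⟩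
  simp [compGraphs]

theorem compGraphs_zero_of_nonempty {V : Type*} [Finite V] [Nonempty V] :
    compGraphs S {0} V = ∅ :=
  Set.eq_empty_of_forall_notMem fun H hH => by
    have : Nonempty H.ConnectedComponent := ‹Nonempty V›.map H.connectedComponentMk
    exact Nat.card_pos.ne' hH.1

/-- The empty graph, with no components, counts here but not in `countAll`; this is the 1 in `1 +
A`. -/
theorem ncard_compGraphs_zero (N : Set ℕ) [Decidable (0 ∈ N)] :
    (compGraphs S N (Fin 0)).ncard = if 0 ∈ N then 1 else 0 := by
  split_ifs with h
  · rw [Set.eq_univ_of_forall fun H => (mem_compGraphs_of_isEmpty H).2 h, Set.ncard_univ]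
    exact Nat.card_unique
  · rw [Set.ncard_eq_zero]
    exact Set.eq_empty_of_forall_notMem fun H hH => h ((mem_compGraphs_of_isEmpty H).1 hH)

theorem countComponents_eq_ncard {k : ℕ} (hk : 0 < k) (n : ℕ) :
    countComponents S k n = (compGraphs S {k} (Fin n)).ncard := by
  classical
  rcases eq_or_ne n 0 with rfl | hn
  · rw [countComponents, ncard_spanningSubgraphs_zero, ncard_compGraphs_zero, if_neg]
    exact hk.ne
  · exact ncard_spanningSubgraphs hn fun H hH =>
      (mem_compGraphs_congr (N := {k}) (H.spanningCoeEquivCoeOfSpanning hH)).symm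

theorem constantCoeff_expGenFun (a : ℕ → ℕ) :
    PowerSeries.constantCoeff (expGenFun a) = a 0 := by
  rw [← PowerSeries.coeff_zero_eq_constantCoeff_apply, expGenFun, PowerSeries.coeff_mk]
  simp

theorem constantCoeff_expGenFun_countIso :
    PowerSeries.constantCoeff (expGenFun (countIso S)) = 0 := by
  rw [constantCoeff_expGenFun, countIso, ncard_spanningSubgraphs_zero, Nat.cast_zero]

/-! ### Solving the equation -/

theorem expGenFun_compGraphs_singleton (hS : ∀ G ∈ S, G.graph.Connected) (k : ℕ) :
    (expGenFun fun n => (compGraphs S {k} (Fin n)).ncard) =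
      PowerSeries.C (1 / (k.factorial : ℚ)) * expGenFun (countIso S) ^ k := by
  classical
  induction k with
  | zero =>
    ext n
    rw [expGenFun, PowerSeries.coeff_mk]
    cases n with
    | zero => simp [ncard_compGraphs_zero]
    | succ n => simp [compGraphs_zero_of_nonempty, PowerSeries.coeff_one]
  | succ k ih =>
    have hset : {j | j + 1 ∈ ({k + 1} : Set ℕ)} = {k} := by
      ext j
      simp
    apply PowerSeries.derivative.ext
    · rw [derivative_expGenFun_compGraphs hS, hset, ih, ← funext countIso_eq_ncard,
        Derivation.leibniz, PowerSeries.derivative_C, PowerSeries.derivative_pow]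
      have hC : PowerSeries.C (1 / ((k + 1).factorial : ℚ)) * ((k + 1 : ℕ) : PowerSeries ℚ) =
          PowerSeries.C (1 / (k.factorial : ℚ)) := by
        rw [← map_natCast (PowerSeries.C (R := ℚ)), ← map_mul, Nat.factorial_succ]
        congr 1
        push_cast
        field_simp
      rw [← hC, smul_zero, add_zero, smul_eq_mul, Nat.add_sub_cancel]
      ring
    · rw [constantCoeff_expGenFun, ncard_compGraphs_zero, map_mul, map_pow,
        constantCoeff_expGenFun_countIso]
      simp

theorem one_add_expGenFun_countAll :
    1 + expGenFun (countAll S) = expGenFun fun n => (compGraphs S Set.univ (Fin n)).ncard := by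
  classical
  ext n
  rw [map_add, expGenFun, expGenFun, PowerSeries.coeff_mk, PowerSeries.coeff_mk,
    PowerSeries.coeff_one]
  cases n with
  | zero => simp [countAll_zero, ncard_compGraphs_zero]
  | succ n => simp [countAll_eq_ncard]

theorem derivative_one_add_expGenFun_countAll (hS : ∀ G ∈ S, G.graph.Connected) :
    PowerSeries.derivative ℚ (1 + expGenFun (countAll S)) =
      (1 + expGenFun (countAll S)) * PowerSeries.derivative ℚ (expGenFun (countIso S)) := by
  rw [one_add_expGenFun_countAll, derivative_expGenFun_compGraphs hS, ← funext countIso_eq_ncard]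
  rfl

end FinGraph


theorem mainTheorem8 (S : Set FinGraph) (hS : ∀ G ∈ S, G.graph.Connected)
    (C A : PowerSeries ℚ)
    (hC : C = FinGraph.expGenFun (FinGraph.countIso S))
    (hA : A = FinGraph.expGenFun (FinGraph.countAll S)) :
    -- exactly `k` components
    (∀ k : ℕ, 0 < k →
      FinGraph.expGenFun (FinGraph.countComponents S k) =
        PowerSeries.C (1 / (k.factorial : ℚ)) * C ^ k) ∧
    -- the zeroth coefficients vanish, so that the exponential and logarithm below make sense
    PowerSeries.constantCoeff C = 0 ∧
    PowerSeries.constantCoeff A = 0 ∧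
    1 + A = (PowerSeries.exp ℚ).subst C ∧
    PowerSeries.logOf (1 + A) = C ∧
    PowerSeries.derivative ℚ A = (1 + A) * PowerSeries.derivative ℚ C := by
  subst hC hA
  have hC0 := FinGraph.constantCoeff_expGenFun_countIso (S := S)
  have hA0 : PowerSeries.constantCoeff (FinGraph.expGenFun (FinGraph.countAll S)) = 0 := by
    rw [FinGraph.constantCoeff_expGenFun, FinGraph.countAll_zero, Nat.cast_zero]
  have hB0 : PowerSeries.constantCoeff (1 + FinGraph.expGenFun (FinGraph.countAll S)) = 1 := by
    rw [map_add, map_one, hA0, add_zero]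
  have hB := FinGraph.derivative_one_add_expGenFun_countAll hS
  refine ⟨fun k hk => ?_, hC0, hA0, ?_, ?_, ?_⟩
  · rw [funext (FinGraph.countComponents_eq_ncard hk), FinGraph.expGenFun_compGraphs_singleton hS]
  · exact PowerSeries.eq_of_derivative_eq_mul hB (PowerSeries.derivative_exp_subst hC0)
      (by rw [hB0, PowerSeries.constantCoeff_exp_subst hC0])
  · apply PowerSeries.derivative.ext
    -- Both derivatives agree after multiplication by `1 + A`, which is cancellable because its
    -- constant term is 1.
    · have hne : 1 + FinGraph.expGenFun (FinGraph.countAll S) ≠ 0 := fun h => by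
        rw [h, map_zero] at hB0
        exact zero_ne_one hB0
      exact mul_left_cancel₀ hne ((PowerSeries.derivative_logOf hB0).trans hB)
    · rw [PowerSeries.constantCoeff_logOf hB0, hC0]
  · rw [← hB, map_add, PowerSeries.derivative_one, zero_add]
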